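/- Let $\Gamma=(I,E,m)$ be a finite simplicial graph with edge labels $m:E\to\mathbb N_{\ge 2}$. Let $A_I$ be the associated Artin–Tits group, generated by $\sigma_i$ ($i\in I$) with the braid relations $\sigma_i\sigma_j\sigma_i\cdots=\sigma_j\sigma_i\sigma_j\cdots$ ($m(i,j)$ letters on each side) for $\{i,j\}\in E$, and let $W_I$ be the associated Coxeter group, generated by $s_i$ ($i\in I$) with the same relations and $s_i^2=1$. Let $X\subseteq I$, let $\Gamma_X$ be the full labelled subgraph spanned by $X$ and $A_X$ its Artin–Tits group; put $S_X=\{s_i\mid i\in X\}$ and let $W_X$ be the subgroup of $W_I$ generated by $S_X$. Write $\Sigma_I=\{\sigma_i\mid i\in I\}$, $\Sigma_X=\{\sigma_i\mid i\in X\}$, and $S^*$ for the set of words on $S$. An element of $W_I$ is called $(X,\emptyset)$-reduced if it has minimal length in its coset $W_Xw$; every $u\in W_I$ can be written in a unique way $u=vw$ with $v\in W_X$ and $w$ an $(X,\emptyset)$-reduced element. For a word $w=s_{i_1}\cdots s_{i_k}$ let $R(w)=(r_1(w),\dots,r_k(w))$ be the sequence of the elements $r_j(w)=s_{i_1}\cdots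 s_{i_{j-1}}s_{i_j}s_{i_{j-1}}\cdots s_{i_1}$ of $W_I$. Let $j_1<\dots<j_p$ be the positions $j$ with $r_j(w)\in W_X$. There is a unique word $w_X=s_{q_1}\cdots s_{q_p}$ on $S_X$ such that $R(w_X)=(r_{j_1}(w),\dots,r_{j_p}(w))$. For a word $\omega=\sigma_{i_1}^{\varepsilon_1}\cdots\sigma_{i_k}^{\varepsilon_k}$ on $\Sigma_I\cup\Sigma_I^{-1}$ ($\varepsilon_j=\pm1$), define two words on $\Sigma_X\cup\Sigma_X^{-1}$ as follows. (a) Put $w=s_{i_1}\cdots s_{i_k}$ and, with the above notation, $\pi^*_{I,X}(\omega)=\sigma_{q_1}^{\varepsilon_{j_1}}\cdots\sigma_{q_p}^{\varepsilon_{j_p}}$. (b) (Blufstein–Paris) For $0\le j\le k$ write $s_{i_1}\cdots s_{i_j}=v_jw_j$ in $W_I$ with $v_j\in W_X$ and $w_j$ an $(X,\emptyset)$-reduced element. Put $t_j=w_{j-1}s_{i_j}w_{j-1}^{-1}$ if $\varepsilon_j=1$ and $t_j=w_js_{i_j}w_j^{-1}$ if $\varepsilon_j=-1$. If $t_j=s_q$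 with $q\in X$, let $\tau_j=\sigma_q^{\varepsilon_j}$; if $t_j\notin S_X$, let $\tau_j$ be the empty word. Put $\hat\pi_X(\omega)=\tau_1\cdots\tau_k$. Then these definitions are meaningful (the decomposition $u=vw$ and the word $w_X$ exist and are unique, as asserted above), and the maps $\pi^*_{I,X}$ and $\hat\pi_X$ from $(\Sigma_I\cup\Sigma_I^{-1})^*$ to $(\Sigma_X\cup\Sigma_X^{-1})^*$ coincide. Moreover $\pi^*_{I,X}$ induces a map $\pi_{I,X}:A_I\to A_X$ and $\hat\pi_X$ induces a map $\pi_X:A_I\to A_X$ (words representing the same element of $A_I$ are sent to words representing the same element of $A_X$), and $\pi_{I,X}=\pi_X$. -/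

import Mathlib

/-!
A Coxeter matrix `M` on `I` encodes a labelled graph on `I`: distinct vertices `i`, `j` span an edge
exactly when `M i j ≠ 0`, and then `M i j ≥ 2` is the label of that edge.  The Coxeter group `W_I`
is Mathlib's `M.Group`.
-/

namespace ArtinTits

noncomputable section

universe u

variable {I : Type u}

/-! ### Artin-Tits groups and words -/

/-- The labelled full subgraph spanned by `X`. -/
def restrict (M : CoxeterMatrix I) (X : Set I) : CoxeterMatrix X where
  M := M.M.submatrix Subtype.val Subtype.val
  isSymm := M.isSymm.submatrix _
  diagonal i := M.diagonal i
  off_diagonal i j h := M.off_diagonal i j (fun e => h (Subtype.ext e))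

/-- The positive word `i j i j ⋯` of the braid relation, as an element of the free group
(it has `M i j` letters). -/
def braidElement (M : CoxeterMatrix I) (i j : I) : FreeGroup I :=
  ((CoxeterSystem.braidWord M i j).map FreeGroup.of).prod

/-- The relators of the Artin-Tits group: one for each edge `{i, j}` of the graph
(counted in both orders). -/
def relators (M : CoxeterMatrix I) : Set (FreeGroup I) :=
  {r | ∃ i j : I, i ≠ j ∧ M i j ≠ 0 ∧ r = braidElement M i j * (braidElement M j i)⁻¹}

/-- The Artin-Tits group `A_I`. -/
abbrev ArtinGroup (M : CoxeterMatrix I) : Type u := PresentedGroup (relators M)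

/-- Words on `Σ_I ∪ Σ_I⁻¹`: the letter `(i, true)` is `σ_i` and `(i, false)` is `σ_i⁻¹`. -/
abbrev SignedWord (I : Type u) : Type u := List (I × Bool)

/-- The element of `A_I` represented by a word on `Σ_I ∪ Σ_I⁻¹`. -/
def toArtin (M : CoxeterMatrix I) (ω : SignedWord I) : ArtinGroup M :=
  PresentedGroup.mk (relators M) (FreeGroup.mk ω)

theorem toArtin_surjective (M : CoxeterMatrix I) : Function.Surjective (toArtin M) := by
  intro a
  obtain ⟨g, rfl⟩ := PresentedGroup.mk_surjective (relators M) a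
  obtain ⟨ω, rfl⟩ := Quot.exists_rep g
  exact ⟨ω, rfl⟩

/-- The map `θ*` on words, forgetting the exponents. -/
def thetaStar (ω : SignedWord I) : List I := ω.map Prod.fst

/-! ### Coxeter groups -/

/-- The element of `W_I` represented by a word on `S_I`. -/
def toCoxeter (M : CoxeterMatrix I) (w : List I) : M.Group := M.toCoxeterSystem.wordProd w

/-- The length on `W_I` with respect to `S_I`. -/
def len (M : CoxeterMatrix I) (u : M.Group) : ℕ := M.toCoxeterSystem.length u

/-- The standard parabolic subgroup `W_X` of `W_I`, generated by `S_X`. -/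
def parabolic (M : CoxeterMatrix I) (X : Set I) : Subgroup M.Group :=
  Subgroup.closure (M.simple '' X)

/-- `w` is `(X, Y)`-reduced: it has minimal length in the double coset `W_X w W_Y`. -/
def IsReduced (M : CoxeterMatrix I) (X Y : Set I) (w : M.Group) : Prop :=
  ∀ u ∈ DoubleCoset.doubleCoset w (parabolic M X : Set M.Group) (parabolic M Y : Set M.Group),
    len M w ≤ len M u

/-- `u = v w` with `v` in `W_X` and `w` an `(X, ∅)`-reduced element. -/
def IsDecomposition (M : CoxeterMatrix I) (X : Set I) (u v w : M.Group) : Prop :=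
  v ∈ parabolic M X ∧ IsReduced M X ∅ w ∧ u = v * w

theorem exists_isDecomposition (M : CoxeterMatrix I) (X : Set I) (u : M.Group) :
    ∃ w v : M.Group, IsDecomposition M X u v w := by
  classical
  have hex : ∃ n : ℕ, ∃ v ∈ parabolic M X, len M (v⁻¹ * u) = n := ⟨_, 1, one_mem _, rfl⟩
  obtain ⟨v, hv, hlen⟩ := Nat.find_spec hex
  refine ⟨v⁻¹ * u, v, hv, ?_, by group⟩
  intro x hx
  obtain ⟨a, ha, b, hb, rfl⟩ := DoubleCoset.mem_doubleCoset.mp hx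
  have hb1 : b = 1 := by simpa [parabolic] using hb
  subst hb1
  rw [hlen]
  refine Nat.find_min' hex ⟨v * a⁻¹, mul_mem hv (inv_mem ha), ?_⟩
  congr 1
  group

/-- The `(X, ∅)`-reduced element `w` in the decomposition `u = v w` with `v` in `W_X`. -/
def reducedPart (M : CoxeterMatrix I) (X : Set I) (u : M.Group) : M.Group :=
  (exists_isDecomposition M X u).choose

/-! ### The word map defined through sequences of reflections -/

/-- The sequence `R(w) = (r_1, …, r_k)` in `W_I` attached to a word `w = s_{i_1} ⋯ s_{i_k}`, where
`r_j = s_{i_1} ⋯ s_{i_{j-1}} s_{i_j} s_{i_{j-1}} ⋯ s_{i_1}`. -/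
def reflSeq (M : CoxeterMatrix I) (w : List I) : List M.Group := M.toCoxeterSystem.leftInvSeq w

open Classical in
/-- The subsequence of `R(w)` formed by its terms lying in `W_X`. -/
def reflSeqIn (M : CoxeterMatrix I) (X : Set I) (w : List I) : List M.Group :=
  (reflSeq M w).filter (fun r => r ∈ parabolic M X)

open Classical in
/-- The exponents `ε_j` of the letters of `ω` at the positions `j` for which the `j`-th term of
`R(θ* ω)` lies in `W_X`. -/
def keptSigns (M : CoxeterMatrix I) (X : Set I) (ω : SignedWord I) : List Bool :=
  (((reflSeq M (thetaStar ω)).zip (ω.map Prod.snd)).filter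
    (fun p => p.1 ∈ parabolic M X)).map Prod.snd

/-- `v` is a word on `S_X` whose sequence `R(v)` is the subsequence of the terms of `R(w)` that lie
in `W_X`. -/
def IsProjectedWord (M : CoxeterMatrix I) (X : Set I) (w : List I) (v : List X) : Prop :=
  reflSeq M (v.map Subtype.val) = reflSeqIn M X w

open Classical in
/-- The word `w_X` on `S_X` with `R(w_X)` equal to the subsequence of the terms of `R(w)` that lie
in `W_X` (with an irrelevant default value in case there were no such word). -/
def projectedWord (M : CoxeterMatrix I) (X : Set I) (w : List I) : List X :=
  if h : ∃ v : List X, IsProjectedWord M X w v then h.choose else []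

/-- The word map `π*_{I,X}`: the letters of `w_X`, with the exponents inherited from `ω`. -/
def piStar (M : CoxeterMatrix I) (X : Set I) (ω : SignedWord I) : SignedWord X :=
  (projectedWord M X (thetaStar ω)).zip (keptSigns M X ω)

/-! ### The word map of Blufstein and Paris -/

/-- The element `w_j`, for `0 ≤ j ≤ k`: the `(X, ∅)`-reduced part of `s_{i_1} ⋯ s_{i_j}`. -/
def prefixReduced (M : CoxeterMatrix I) (X : Set I) (ω : SignedWord I) (j : ℕ) : M.Group :=
  reducedPart M X (toCoxeter M ((thetaStar ω).take j))

/-- The element `t` attached to the letter of `ω` in position `j`, positions being counted from `0`: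
with the usual count from `1` it is `w_{j-1} s_{i_j} w_{j-1}⁻¹` if `ε_j = 1`, and
`w_j s_{i_j} w_j⁻¹` if `ε_j = -1`. -/
def hatReflection (M : CoxeterMatrix I) (X : Set I) (ω : SignedWord I) (j : Fin ω.length) :
    M.Group :=
  let w := if (ω.get j).2 = true then prefixReduced M X ω j else prefixReduced M X ω (j + 1)
  w * M.simple (ω.get j).1 * w⁻¹

open Classical in
/-- The word `τ`, of length at most one, attached to the letter of `ω` in position `j`. -/
def hatLetter (M : CoxeterMatrix I) (X : Set I) (ω : SignedWord I) (j : Fin ω.length) :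
    SignedWord X :=
  if h : ∃ q : X, hatReflection M X ω j = M.simple q then [(h.choose, (ω.get j).2)] else []

/-- The word map `π̂_X` of Blufstein and Paris: the concatenation `τ_1 ⋯ τ_k`. -/
def piHat (M : CoxeterMatrix I) (X : Set I) (ω : SignedWord I) : SignedWord X :=
  (List.ofFn (hatLetter M X ω)).flatten

/-! ### Induced maps on Artin-Tits groups -/

/-- The word map `φ` induces the map `f : A_I → A_X`. -/
def Induces (M : CoxeterMatrix I) (X : Set I) (φ : SignedWord I → SignedWord X)
    (f : ArtinGroup M → ArtinGroup (restrict M X)) : Prop :=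
  ∀ ω : SignedWord I, f (toArtin M ω) = toArtin (restrict M X) (φ ω)

/-- The map `A_I → A_X` obtained by applying `φ` to a representative word.  When `φ` respects
equivalence of words this is the map induced by `φ`, see `Induces`. -/
def inducedMap (M : CoxeterMatrix I) (X : Set I) (φ : SignedWord I → SignedWord X) :
    ArtinGroup M → ArtinGroup (restrict M X) :=
  fun a => toArtin (restrict M X) (φ (toArtin_surjective M a).choose)

/-- The map `π_{I,X} : A_I → A_X`. -/
def piMap (M : CoxeterMatrix I) (X : Set I) : ArtinGroup M → ArtinGroup (restrict M X) :=
  inducedMap M X (piStar M X)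

/-- The retraction `π_X : A_I → A_X` of Blufstein and Paris. -/
def piBP (M : CoxeterMatrix I) (X : Set I) : ArtinGroup M → ArtinGroup (restrict M X) :=
  inducedMap M X (piHat M X)

end

end ArtinTits

/-! Both word maps are the output of one automaton, whose states are the (X, ∅)-reduced elements of
W_I. In state w, a letter σ_i^ε either satisfies w s_i w⁻¹ = s_q with q ∈ X, and then σ_q^ε is
emitted and w is kept, or it satisfies w s_i w⁻¹ ∉ W_X, and then nothing is emitted and the state
becomes w s_i, again reduced. This dichotomy (`exists_simple_eq_conj`, `isReduced_mul_simple`) keeps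
the state equal to the reduced part of the prefix read so far, which gives π̂ (`piHat_eq_project`).
It also makes the emitted word spell exactly the reflections of the input that lie in W_X, which
gives π* (`piStar_eq_project`).

For the induced map, A_I is made to act on pairs (state, element of A_X). Inverse letters cancel
directly; the braid relation on i, j read from a state w is the crux (`toArtin_project_altWord`). If
w conjugates both s_i and s_j into W_X, the outputs are the two sides of a braid relation with the
same label. Otherwise w conjugates at most one nontrivial element of ⟨s_i, s_j⟩ into W_X
(`eq_of_conj_mem_parabolic`), so both sides emit the same word, of at most one letter.

Two facts about Coxeter groups support this. The order of s_i s_j is exactly m(i, j), by the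
geometric representation. Inversions are detected by a cocycle with values in ℤ/2, which yields the
exchange condition and turns statements about coset representatives into parity computations. -/

namespace ArtinTits

noncomputable section

universe u

variable {I : Type u}

/-! ### The geometric representation and the orders of products of two generators -/

section Geometric

open Polynomial.Chebyshev

/-- The coroot of `i`, whose value at the `j`-th basis vector is `-2 cos (π / M i j)`; the conventions
`π / 0 = 0` and `cos 0 = 1` give the usual value `-2` when `M i j = 0`. -/
def coroot (M : CoxeterMatrix I) (i : I) : Module.Dual ℝ (I →₀ ℝ) :=
  Finsupp.linearCombination ℝ (fun j => -2 * Real.cos (Real.pi / M i j))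

theorem coroot_single (M : CoxeterMatrix I) (i j : I) :
    coroot M i (Finsupp.single j 1) = -2 * Real.cos (Real.pi / M i j) := by
  simp [coroot]

theorem coroot_single_self (M : CoxeterMatrix I) (i : I) :
    coroot M i (Finsupp.single i 1) = 2 := by
  simp [coroot_single]

/-- The reflection of the geometric representation attached to `i`. -/
def geomReflection (M : CoxeterMatrix I) (i : I) : (I →₀ ℝ) ≃ₗ[ℝ] (I →₀ ℝ) :=
  Module.reflection (coroot_single_self M i)

/-- This is the parameter at which Chebyshev polynomials express the powers of a product of two
reflections; it identifies that product as a rotation of angle 2π/m. -/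
theorem coroot_mul_coroot (M : CoxeterMatrix I) (i j : I) :
    coroot M i (Finsupp.single j 1) * coroot M j (Finsupp.single i 1) - 2 =
      2 * Real.cos (2 * (Real.pi / M i j)) := by
  rw [coroot_single, coroot_single, M.symmetric j i, Real.cos_two_mul]
  ring

theorem sin_two_mul_pi_div_ne_zero {m : ℕ} (hm : 3 ≤ m) : Real.sin (2 * (Real.pi / m)) ≠ 0 := by
  have hm' : (3 : ℝ) ≤ m := by exact_mod_cast hm
  have hpi := Real.pi_pos
  apply ne_of_gt
  apply Real.sin_pos_of_pos_of_lt_pi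
  · positivity
  · rw [← mul_div_assoc, div_lt_iff₀ (by linarith)]
    nlinarith

/-- With θ = 2π/m, the identity S_n(2 cos θ) sin θ = sin((n+1)θ) makes both coefficients of the
power formula vanish for m ≥ 3. The case m = 2 is separate because sin θ = 0 there. -/
theorem geomReflection_mul_pow (M : CoxeterMatrix I) (i j : I) :
    (geomReflection M i * geomReflection M j) ^ M i j = 1 := by
  rcases eq_or_ne i j with rfl | hij
  · rw [M.diagonal, pow_one]
    ext1 v
    exact Module.involutive_reflection (coroot_single_self M i) v
  obtain h0 | h1 | h2 | h3 : M i j = 0 ∨ M i j = 1 ∨ M i j = 2 ∨ 3 ≤ M i j := by omega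
  · simp [h0]
  · exact absurd h1 (M.off_diagonal i j hij)
  · have h2' : M j i = 2 := by rw [M.symmetric j i, h2]
    have hi : coroot M i (Finsupp.single j 1) = 0 := by simp [coroot_single, h2]
    have hj : coroot M j (Finsupp.single i 1) = 0 := by simp [coroot_single, h2']
    rw [h2, pow_two]
    ext1 v
    simp only [LinearEquiv.mul_apply, LinearEquiv.coe_one, id_eq, geomReflection,
      Module.reflection_apply, map_sub, map_smul, hi, hj, coroot_single_self]
    module
  · have hs := sin_two_mul_pi_div_ne_zero h3
    have key (v : I →₀ ℝ) := Module.reflection_mul_reflection_pow_apply (coroot_single_self M i)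
      (coroot_single_self M j) (M i j) v _ (coroot_mul_coroot M i j).symm
    generalize M i j = m at *
    set t := 2 * Real.cos (2 * (Real.pi / m)) with ht
    have hmpos : (m : ℝ) ≠ 0 := by
      have : m ≠ 0 := by omega
      exact_mod_cast this
    have hS (n : ℤ) : (S ℝ n).eval t * Real.sin (2 * (Real.pi / m)) =
        Real.sin ((n + 1) * (2 * (Real.pi / m))) := S_two_mul_real_cos _ n
    ext1 v
    change ((Module.reflection (coroot_single_self M i) *
      Module.reflection (coroot_single_self M j)) ^ m) v = v
    rw [key v]
    rcases Nat.even_or_odd' m with ⟨k, hk | hk⟩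
    -- For m = 2k both coefficients contain S_{k-1}, and kθ = π.
    · have h0 : (S ℝ ((k : ℤ) - 1)).eval t = 0 := by
        have := hS ((k : ℤ) - 1)
        have e : (((k : ℤ) - 1 : ℤ) + 1 : ℝ) * (2 * (Real.pi / m)) = Real.pi := by
          have : (m : ℝ) = 2 * k := by exact_mod_cast hk
          rw [this] at hmpos ⊢
          push_cast
          have : (k : ℝ) ≠ 0 := by intro h; simp [h] at hmpos
          field_simp
          ring
        rw [e, Real.sin_pi] at this
        exact (mul_eq_zero.mp this).resolve_right hs
      have e1 : ((m : ℤ) - 2) / 2 = (k : ℤ) - 1 := by omega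
      have e2 : ((m : ℤ) - 1) / 2 = (k : ℤ) - 1 := by omega
      rw [e1, e2, h0]
      simp
    -- For m = 2k + 1 both coefficients contain S_k + S_{k-1}, where (k+1)θ = π + π/m and kθ = π -
    -- π/m have opposite sines.
    · have h0 : (S ℝ (k : ℤ)).eval t + (S ℝ ((k : ℤ) - 1)).eval t = 0 := by
        have h1 := hS k
        have h2 := hS ((k : ℤ) - 1)
        have e : (m : ℝ) = 2 * k + 1 := by exact_mod_cast hk
        have e' : (2 * (k : ℝ) + 1) * (Real.pi / m) = Real.pi := by
          rw [← e]; field_simp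
        have s1 : Real.sin (((k : ℤ) + 1 : ℝ) * (2 * (Real.pi / m))) =
            -Real.sin (Real.pi / m) := by
          rw [← Real.sin_add_pi]
          congr 1
          push_cast
          linarith
        have s2 : Real.sin ((((k : ℤ) - 1 : ℤ) + 1 : ℝ) * (2 * (Real.pi / m))) =
            Real.sin (Real.pi / m) := by
          rw [← Real.sin_pi_sub]
          congr 1
          push_cast
          linarith
        rw [s1] at h1
        rw [s2] at h2
        apply (mul_eq_zero.mp _).resolve_right hs
        rw [add_mul, h1, h2]
        ring
      have e1 : ((m : ℤ) - 2) / 2 = (k : ℤ) - 1 := by omega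
      have e2 : ((m : ℤ) - 1) / 2 = (k : ℤ) := by omega
      have e3 : ((m : ℤ) - 3) / 2 = (k : ℤ) - 1 := by omega
      have e4 : (m : ℤ) / 2 = (k : ℤ) := by omega
      rw [e1, e2, e3, e4, h0]
      simp

/-- The geometric representation. -/
def geomRep (M : CoxeterMatrix I) : M.Group →* ((I →₀ ℝ) ≃ₗ[ℝ] (I →₀ ℝ)) :=
  M.toCoxeterSystem.lift ⟨geomReflection M, geomReflection_mul_pow M⟩

theorem geomRep_simple (M : CoxeterMatrix I) (i : I) :
    geomRep M (M.simple i) = geomReflection M i :=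
  M.toCoxeterSystem.lift_apply_simple (geomReflection_mul_pow M) i

theorem simple_injective (M : CoxeterMatrix I) : Function.Injective M.simple := by
  intro i j h
  by_contra hij
  have h1 := congrArg (fun g => geomRep M g (Finsupp.single i 1) i) h
  simp only [geomRep_simple, geomReflection, Module.reflection_apply, coroot_single_self] at h1
  norm_num [hij] at h1

/-- If (s_i s_j)^n = 1, comparing coordinates of the image of the basis vector e_i gives, for m ≥ 3,
sin(nθ) = 0 and sin((n+1)θ) = sin θ with θ = 2π/m. Hence cos(nθ) = 1 and m divides n. -/
theorem orderOf_simple_mul_simple (M : CoxeterMatrix I) (i j : I) :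
    orderOf (M.simple i * M.simple j) = M i j := by
  rcases eq_or_ne i j with rfl | hij
  · rw [M.diagonal, orderOf_eq_one_iff]
    exact M.toCoxeterSystem.simple_mul_simple_self i
  have hdvd : orderOf (M.simple i * M.simple j) ∣ M i j :=
    orderOf_dvd_of_pow_eq_one (M.toCoxeterSystem.simple_mul_simple_pow i j)
  refine Nat.dvd_antisymm hdvd ?_
  obtain ⟨n, hn⟩ : ∃ n, n = orderOf (M.simple i * M.simple j) := ⟨_, rfl⟩
  have hpow : (M.simple i * M.simple j) ^ n = 1 := hn ▸ pow_orderOf_eq_one _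
  rw [← hn] at hdvd ⊢
  have hact := Module.reflection_mul_reflection_pow_apply_self (coroot_single_self M i)
    (coroot_single_self M j) n _ (coroot_mul_coroot M i j).symm
  have hfix : ((Module.reflection (coroot_single_self M i) *
      Module.reflection (coroot_single_self M j)) ^ n) (Finsupp.single i 1) =
      Finsupp.single i (1 : ℝ) := by
    have := congrArg (fun g => geomRep M g (Finsupp.single i 1)) hpow
    rwa [map_pow, map_mul, geomRep_simple, geomRep_simple, map_one] at this
  rw [hfix] at hact
  have hi := congrArg (fun v => v i) hact
  have hj := congrArg (fun v => v j) hact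
  simp only [Finsupp.add_apply, Finsupp.smul_apply, Finsupp.single_eq_same, Finsupp.single_eq_of_ne hij,
    Finsupp.single_eq_of_ne hij.symm, smul_eq_mul, mul_one, mul_zero, add_zero, zero_add] at hi hj
  have hji : coroot M j (Finsupp.single i 1) = -2 * Real.cos (Real.pi / M i j) := by
    rw [coroot_single, M.symmetric j i]
  rw [hji] at hj
  obtain h0 | h1 | h2 | h3 : M i j = 0 ∨ M i j = 1 ∨ M i j = 2 ∨ 3 ≤ M i j := by omega
  -- Here the Chebyshev parameter is 2 and S_{n-1}(2) = n, so the vanishing e_j-coordinate forces n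
  -- = 0.
  · rw [h0] at hj ⊢
    simp [S_eval_two] at hj
    simp [hj]
  · exact absurd h1 (M.off_diagonal i j hij)
  · rw [h2] at hdvd ⊢
    rcases (Nat.dvd_prime Nat.prime_two).mp hdvd with rfl | rfl
    · rw [pow_one] at hpow
      refine absurd (simple_injective M ?_) hij
      rw [← mul_one (M.simple i), ← M.toCoxeterSystem.simple_mul_simple_self j, ← mul_assoc]
      change M.simple i * M.simple j * M.simple j = _
      rw [hpow, one_mul]
    · rfl
  · have hs := sin_two_mul_pi_div_ne_zero h3
    generalize M i j = m at *
    have hS (k : ℤ) : (S ℝ k).eval (2 * Real.cos (2 * (Real.pi / m))) *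
        Real.sin (2 * (Real.pi / m)) = Real.sin ((k + 1) * (2 * (Real.pi / m))) :=
      S_two_mul_real_cos _ k
    have hcos : Real.cos (Real.pi / m) ≠ 0 := by
      intro h
      rw [Real.sin_two_mul, h, mul_zero] at hs
      exact hs rfl
    have hS1 : (S ℝ ((n : ℤ) - 1)).eval (2 * Real.cos (2 * (Real.pi / m))) = 0 := by
      have := hj.symm
      simpa [hcos] using this
    rw [hS1, add_zero] at hi
    have hsin := hS ((n : ℤ) - 1)
    have hsin' := hS n
    rw [hS1, zero_mul] at hsin
    rw [← hi, one_mul] at hsin'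
    push_cast at hsin hsin'
    rw [sub_add_cancel] at hsin
    rw [add_mul, one_mul, Real.sin_add, ← hsin, zero_mul, zero_add] at hsin'
    have hc1 : Real.cos (n * (2 * (Real.pi / m))) = 1 :=
      (mul_right_cancel₀ hs (by rw [one_mul]; exact hsin')).symm
    obtain ⟨k, hk⟩ := (Real.cos_eq_one_iff _).mp hc1
    have hm0 : (m : ℝ) ≠ 0 := by
      have : m ≠ 0 := by omega
      exact_mod_cast this
    have hpi := Real.pi_ne_zero
    have hk' : (k : ℝ) * m = n := by
      field_simp at hk
      linarith
    have : (k : ℤ) * m = n := by exact_mod_cast hk'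
    exact Int.natCast_dvd_natCast.mp ⟨k, by rw [← this, mul_comm]⟩

end Geometric

end

end ArtinTits

/-! ### Parities of inversions and the exchange condition -/

namespace CoxeterSystem

noncomputable section

open List

variable {B : Type*} {W : Type*} [Group W] {M : CoxeterMatrix B} (cs : CoxeterSystem M W)

/-- The alternating word `i j i ⋯` with `n` letters, starting with `i`. -/
def altWord (i j : B) : ℕ → List B
  | 0 => []
  | n + 1 => i :: altWord j i n

/-- `alternatingWord` fixes its last letter and `altWord` its first, hence the dependence on parity;
the recursions below consume words from the front. -/
theorem alternatingWord_eq_altWord (i j : B) (n : ℕ) :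
    alternatingWord i j n = if Even n then altWord i j n else altWord j i n := by
  induction n with
  | zero => simp [alternatingWord, altWord]
  | succ n ih =>
    rw [alternatingWord_succ', ih]
    by_cases h : Even n <;> simp [h, Nat.even_add_one, altWord]

theorem leftInvSeq_altWord (i j : B) (n : ℕ) :
    cs.leftInvSeq (altWord i j n) =
      (range n).map (fun k => (cs.simple i * cs.simple j) ^ k * cs.simple i) := by
  induction n generalizing i j with
  | zero => rfl
  | succ n ih =>
    rw [altWord, leftInvSeq, ih, range_succ_eq_map, map_cons, map_map, map_map]
    simp only [pow_zero, one_mul, cons.injEq, true_and]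
    apply map_congr_left
    intro k _
    simp only [Function.comp_apply, MulAut.conj_apply, inv_simple, Nat.succ_eq_add_one]
    have : ∀ k : ℕ, cs.simple i * (cs.simple j * cs.simple i) ^ k =
        (cs.simple i * cs.simple j) ^ k * cs.simple i := by
      intro k
      induction k with
      | zero => simp
      | succ k ih => rw [pow_succ, ← mul_assoc, ih, pow_succ]; simp only [mul_assoc]
    rw [← mul_assoc, this, pow_succ]
    simp only [mul_assoc]

theorem leftInvSeq_append (ω ω' : List B) :
    cs.leftInvSeq (ω ++ ω') =
      cs.leftInvSeq ω ++ (cs.leftInvSeq ω').map (MulAut.conj (cs.wordProd ω)) := by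
  induction ω with
  | nil => simp
  | cons i ω ih =>
    rw [cons_append, leftInvSeq, ih, leftInvSeq, map_append, map_map, cons_append, wordProd_cons,
      map_mul]
    rfl

open Classical in
/-- The involution `(t, z) ↦ (sᵢ t sᵢ, z + [t = sᵢ])`. -/
def parityPerm (i : B) : Equiv.Perm (W × ZMod 2) :=
  Function.Involutive.toPerm
    (fun p => (cs.simple i * p.1 * cs.simple i, p.2 + if p.1 = cs.simple i then 1 else 0)) <| by
    rintro ⟨t, z⟩
    by_cases h : t = cs.simple i
    · simp [h, add_assoc, CharTwo.add_self_eq_zero]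
    · have : ¬ cs.simple i * t * cs.simple i = cs.simple i := by
        intro h'
        apply h
        have := congrArg (fun x => cs.simple i * x * cs.simple i) h'
        simpa [mul_assoc] using this
      simp only [h, this]
      simp [mul_assoc]

open Classical in
-- Because of the reversal the first letter acts first. When the k-th letter acts, t has been
-- conjugated by the preceding prefix, so it equals that letter exactly when t is the k-th
-- reflection.
theorem prod_map_parityPerm_reverse (ω : List B) (t : W) (z : ZMod 2) :
    (ω.reverse.map cs.parityPerm).prod (t, z) =
      ((cs.wordProd ω)⁻¹ * t * cs.wordProd ω, z + ((cs.leftInvSeq ω).count t : ZMod 2)) := by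
  induction ω generalizing t z with
  | nil => simp
  | cons i ω ih =>
    rw [reverse_cons, map_append, prod_append, Equiv.Perm.mul_apply, map_singleton, prod_singleton]
    change (ω.reverse.map cs.parityPerm).prod
      (cs.simple i * t * cs.simple i, z + if t = cs.simple i then 1 else 0) = _
    rw [ih, wordProd_cons, leftInvSeq, count_cons]
    have hc : count (cs.simple i * t * cs.simple i) (cs.leftInvSeq ω) =
        count t ((cs.leftInvSeq ω).map (MulAut.conj (cs.simple i))) := by
      have ht : t = MulAut.conj (cs.simple i) (cs.simple i * t * cs.simple i) := by
        simp [mul_assoc]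
      conv_rhs => rw [ht]
      rw [count_map_of_injective _ _ (MulAut.conj (cs.simple i)).injective]
    rw [hc, Prod.mk.injEq]
    refine ⟨by simp [mul_assoc], ?_⟩
    by_cases h : t = cs.simple i
    · simp [h, add_assoc, add_comm]
    · simp [h, Ne.symm h]

theorem isLiftable_parityPerm : M.IsLiftable cs.parityPerm := by
  classical
  intro i j
  have hprod : ∀ n : ℕ, (cs.parityPerm i * cs.parityPerm j) ^ n =
      ((altWord j i (2 * n)).reverse.map cs.parityPerm).prod := by
    intro n
    induction n with
    | zero => rfl
    | succ n ih =>
      rw [pow_succ, ih, mul_add, mul_one]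
      simp [altWord]
  have hword : ∀ n : ℕ, cs.wordProd (altWord j i (2 * n)) = (cs.simple j * cs.simple i) ^ n := by
    intro n
    induction n with
    | zero => simp [altWord]
    | succ n ih =>
      rw [pow_succ', ← ih, mul_add, mul_one]
      simp [altWord, wordProd_cons, mul_assoc]
  ext1 ⟨t, z⟩
  rw [hprod, prod_map_parityPerm_reverse, hword, simple_mul_simple_pow', leftInvSeq_altWord,
    two_mul, range_add, map_append, map_map]
  -- Since (s_j s_i)^m = 1, the 2m reflections run twice through the same m terms, so every count is
  -- even.
  have : ((fun k => (cs.simple j * cs.simple i) ^ k * cs.simple j) ∘ fun x => M i j + x) =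
      fun k => (cs.simple j * cs.simple i) ^ k * cs.simple j := by
    ext k
    simp [pow_add]
  rw [this, count_append]
  simp [CharTwo.add_self_eq_zero]

/-- The parity of the number of occurrences of `t` in the left inversion sequence of any word that
represents `w`. -/
def invParity (w t : W) : ZMod 2 :=
  (cs.lift ⟨cs.parityPerm, cs.isLiftable_parityPerm⟩ w⁻¹ (t, 0)).2

open Classical in
theorem invParity_wordProd (ω : List B) (t : W) :
    cs.invParity (cs.wordProd ω) t = ((cs.leftInvSeq ω).count t : ZMod 2) := by
  rw [invParity, ← wordProd_reverse, wordProd, map_list_prod, map_map]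
  have : (cs.lift ⟨cs.parityPerm, cs.isLiftable_parityPerm⟩ : W → _) ∘ cs.simple =
      cs.parityPerm := by
    ext1 i
    exact cs.lift_apply_simple cs.isLiftable_parityPerm i
  rw [this, prod_map_parityPerm_reverse, zero_add]

theorem invParity_mul (u v t : W) :
    cs.invParity (u * v) t = cs.invParity u t + cs.invParity v (u⁻¹ * t * u) := by
  classical
  obtain ⟨ω, rfl⟩ := cs.wordProd_surjective u
  obtain ⟨ω', rfl⟩ := cs.wordProd_surjective v
  rw [← wordProd_append, invParity_wordProd, invParity_wordProd, invParity_wordProd,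
    leftInvSeq_append, count_append, Nat.cast_add]
  congr 2
  have ht : t = MulAut.conj (cs.wordProd ω) ((cs.wordProd ω)⁻¹ * t * cs.wordProd ω) := by
    simp [mul_assoc]
  conv_lhs => rw [ht]
  rw [count_map_of_injective _ _ (MulAut.conj _).injective]

theorem invParity_one (t : W) : cs.invParity 1 t = 0 := by
  classical
  rw [← cs.wordProd_nil, invParity_wordProd]
  simp

open Classical in
theorem invParity_simple (i : B) (t : W) :
    cs.invParity (cs.simple i) t = if t = cs.simple i then 1 else 0 := by
  rw [← cs.wordProd_singleton, invParity_wordProd]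
  by_cases h : t = cs.simple i
  · simp [h]
  · simp [h, Ne.symm h]

variable {cs} in
-- In t = w s w⁻¹ the contributions of w and w⁻¹ cancel, by the cocycle identity for w w⁻¹ = 1; only
-- the middle letter counts.
theorem IsReflection.invParity_self {t : W} (ht : cs.IsReflection t) : cs.invParity t t = 1 := by
  obtain ⟨w, i, rfl⟩ := ht
  have h := cs.invParity_mul w w⁻¹ (w * cs.simple i * w⁻¹)
  rw [mul_inv_cancel, invParity_one] at h
  rw [invParity_mul, invParity_mul, invParity_simple]
  have e1 : w⁻¹ * (w * cs.simple i * w⁻¹) * w = cs.simple i := by group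
  have e2 : (w * cs.simple i)⁻¹ * (w * cs.simple i * w⁻¹) * (w * cs.simple i) =
      cs.simple i := by group
  rw [e1] at h ⊢
  rw [e2, if_pos rfl, add_right_comm, ← h, zero_add]

theorem mem_leftInvSeq_of_invParity_ne_zero {ω : List B} {t : W}
    (h : cs.invParity (cs.wordProd ω) t ≠ 0) : t ∈ cs.leftInvSeq ω := by
  classical
  rw [invParity_wordProd] at h
  by_contra hmem
  exact h (by rw [count_eq_zero_of_not_mem hmem, Nat.cast_zero])

theorem isLeftInversion_of_invParity_ne_zero {w t : W} (h : cs.invParity w t ≠ 0) :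
    cs.IsLeftInversion w t := by
  obtain ⟨ω, hω, rfl⟩ := cs.exists_isReduced w
  exact cs.isLeftInversion_of_mem_leftInvSeq hω (cs.mem_leftInvSeq_of_invParity_ne_zero h)

/-- For the converse, even parity of w at t would be odd parity of t w at t, so t would shorten t w
to w. With `mem_leftInvSeq_of_invParity_ne_zero` this is the strong exchange condition. -/
theorem invParity_ne_zero_iff {w t : W} : cs.invParity w t ≠ 0 ↔ cs.IsLeftInversion w t := by
  refine ⟨cs.isLeftInversion_of_invParity_ne_zero, fun ⟨ht, hlt⟩ h0 => ?_⟩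
  have h1 : cs.invParity (t * w) t ≠ 0 := by
    rw [invParity_mul, ht.invParity_self, inv_mul_cancel, one_mul, h0]
    simp
  have := (cs.isLeftInversion_of_invParity_ne_zero h1).2
  rw [← mul_assoc, ht.mul_self, one_mul] at this
  omega

/-- The deletion property. Taking a sublist ensures that a word on S_X reduces to a word on S_X. -/
theorem exists_isReduced_sublist (ω : List B) :
    ∃ ω', ω' <+ ω ∧ cs.IsReduced ω' ∧ cs.wordProd ω' = cs.wordProd ω := by
  induction ω with
  | nil => exact ⟨[], Sublist.refl _, by simp [IsReduced], rfl⟩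
  | cons i ω ih =>
    obtain ⟨ω', hsub, hred, hprod⟩ := ih
    rw [wordProd_cons, ← hprod]
    rcases cs.length_simple_mul (cs.wordProd ω') i with h | h
    · exact ⟨i :: ω', hsub.cons_cons i, by rw [IsReduced, wordProd_cons, h, hred.eq, length_cons],
        cs.wordProd_cons i ω'⟩
    · have hinv : cs.invParity (cs.wordProd ω') (cs.simple i) ≠ 0 :=
        cs.invParity_ne_zero_iff.mpr ⟨cs.isReflection_simple i, by omega⟩
      obtain ⟨k, hk, hki⟩ := mem_iff_getElem.mp (cs.mem_leftInvSeq_of_invParity_ne_zero hinv)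
      have he := cs.getD_leftInvSeq_mul_wordProd ω' k
      rw [getD_eq_getElem _ _ hk, hki] at he
      refine ⟨ω'.eraseIdx k, ((eraseIdx_sublist _ _).trans hsub).cons i, ?_, he.symm⟩
      rw [length_leftInvSeq] at hk
      have h1 := length_eraseIdx_add_one hk
      rw [hred.eq] at h
      rw [IsReduced, ← he]
      omega

end

end CoxeterSystem

namespace ArtinTits

noncomputable section

universe u

variable {I : Type u}

/-! ### Parabolic subgroups and reduced elements -/

section Parabolic

variable (M : CoxeterMatrix I)

/-- `invParity` for the Coxeter system of `M`. -/
abbrev parity (w t : M.Group) : ZMod 2 := M.toCoxeterSystem.invParity w t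

variable {M} {X : Set I}

theorem parity_mul (u v t : M.Group) :
    parity M (u * v) t = parity M u t + parity M v (u⁻¹ * t * u) :=
  M.toCoxeterSystem.invParity_mul u v t

theorem parity_simple (i : I) (t : M.Group) [Decidable (t = M.simple i)] :
    parity M (M.simple i) t = if t = M.simple i then 1 else 0 := by
  refine (M.toCoxeterSystem.invParity_simple i t).trans ?_
  congr

theorem simple_mem_parabolic {i : I} (hi : i ∈ X) : M.simple i ∈ parabolic M X :=
  Subgroup.subset_closure ⟨i, hi, rfl⟩

theorem toCoxeter_mem_parabolic {ω : List I} (hω : ∀ i ∈ ω, i ∈ X) :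
    toCoxeter M ω ∈ parabolic M X := by
  induction ω with
  | nil => exact one_mem _
  | cons i ω ih =>
    rw [toCoxeter, CoxeterSystem.wordProd_cons]
    exact mul_mem (simple_mem_parabolic (hω i (by simp)))
      (ih fun j hj => hω j (List.mem_cons_of_mem i hj))

theorem exists_word_of_mem_parabolic {v : M.Group} (hv : v ∈ parabolic M X) :
    ∃ ω : List I, (∀ i ∈ ω, i ∈ X) ∧ toCoxeter M ω = v := by
  induction hv using Subgroup.closure_induction with
  | mem x hx =>
    obtain ⟨i, hi, rfl⟩ := hx
    exact ⟨[i], by simpa using hi, M.toCoxeterSystem.wordProd_singleton i⟩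
  | one => exact ⟨[], by simp, rfl⟩
  | mul x y _ _ hx hy =>
    obtain ⟨ω, hω, rfl⟩ := hx
    obtain ⟨ω', hω', rfl⟩ := hy
    refine ⟨ω ++ ω', ?_, M.toCoxeterSystem.wordProd_append ω ω'⟩
    intro i hi
    rcases List.mem_append.mp hi with h | h
    exacts [hω i h, hω' i h]
  | inv x _ hx =>
    obtain ⟨ω, hω, rfl⟩ := hx
    exact ⟨ω.reverse, fun i hi => hω i (List.mem_reverse.mp hi),
      M.toCoxeterSystem.wordProd_reverse ω⟩

theorem mem_parabolic_of_mem_leftInvSeq {ω : List I} (hω : ∀ i ∈ ω, i ∈ X) {t : M.Group}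
    (ht : t ∈ M.toCoxeterSystem.leftInvSeq ω) : t ∈ parabolic M X := by
  obtain ⟨k, hk, rfl⟩ := List.mem_iff_getElem.mp ht
  rw [CoxeterSystem.length_leftInvSeq] at hk
  rw [CoxeterSystem.getElem_leftInvSeq _ _ _ hk]
  have h := toCoxeter_mem_parabolic (M := M) (ω := ω.take k)
    fun i hi => hω i (List.mem_of_mem_take hi)
  exact mul_mem (mul_mem h (simple_mem_parabolic (hω _ (List.getElem_mem hk)))) (inv_mem h)

theorem mem_parabolic_of_parity_ne_zero {v t : M.Group} (hv : v ∈ parabolic M X)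
    (h : parity M v t ≠ 0) : t ∈ parabolic M X := by
  obtain ⟨ω, hω, rfl⟩ := exists_word_of_mem_parabolic hv
  exact mem_parabolic_of_mem_leftInvSeq hω
    (M.toCoxeterSystem.mem_leftInvSeq_of_invParity_ne_zero h)

/-- A nontrivial element of `W_X` has a left descent in `X`. -/
theorem exists_parity_simple_ne_zero {v : M.Group} (hv : v ∈ parabolic M X) (h1 : v ≠ 1) :
    ∃ q ∈ X, parity M v (M.simple q) ≠ 0 := by
  obtain ⟨ω, hω, rfl⟩ := exists_word_of_mem_parabolic hv
  obtain ⟨ω', hsub, hred, hprod⟩ := M.toCoxeterSystem.exists_isReduced_sublist ω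
  rw [toCoxeter, ← hprod] at h1 ⊢
  cases ω' with
  | nil => exact absurd (M.toCoxeterSystem.wordProd_nil) h1
  | cons q ω' =>
    refine ⟨q, hω q (hsub.subset (by simp)), M.toCoxeterSystem.invParity_ne_zero_iff.mpr ?_⟩
    exact M.toCoxeterSystem.isLeftInversion_of_mem_leftInvSeq hred
      List.mem_cons_self

theorem isReduced_empty_iff_len {w : M.Group} :
    IsReduced M X ∅ w ↔ ∀ v ∈ parabolic M X, len M w ≤ len M (v * w) := by
  constructor
  · intro h v hv
    exact h _ (DoubleCoset.mem_doubleCoset.mpr ⟨v, hv, 1, one_mem _, by simp⟩)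
  · intro h u hu
    obtain ⟨a, ha, b, hb, rfl⟩ := DoubleCoset.mem_doubleCoset.mp hu
    have hb1 : b = 1 := by simpa [parabolic] using hb
    rw [hb1, mul_one]
    exact h a ha

theorem conj_mem_parabolic {v t : M.Group} (hv : v ∈ parabolic M X) :
    v⁻¹ * t * v ∈ parabolic M X ↔ t ∈ parabolic M X := by
  constructor
  · intro h
    have := mul_mem (mul_mem hv h) (inv_mem hv)
    simpa [mul_assoc] using this
  · intro h
    exact mul_mem (mul_mem (inv_mem hv) h) hv

theorem parity_eq_zero_of_isReduced {w t : M.Group} (hw : IsReduced M X ∅ w)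
    (ht : t ∈ parabolic M X) : parity M w t = 0 := by
  by_contra h
  exact absurd (isReduced_empty_iff_len.mp hw t ht)
    (not_le.mpr (M.toCoxeterSystem.isLeftInversion_of_invParity_ne_zero h).2)

/-- The cocycle splits off the parity of w at v⁻¹ t v, which lies in W_X and so cannot be an
inversion of w. Thus parities at W_X determine v, whence uniqueness of decompositions. -/
theorem parity_mul_of_isReduced {v w t : M.Group} (hv : v ∈ parabolic M X)
    (hw : IsReduced M X ∅ w) (ht : t ∈ parabolic M X) : parity M (v * w) t = parity M v t := by
  rw [parity_mul]
  have h0 : parity M w (v⁻¹ * t * v) = 0 :=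
    parity_eq_zero_of_isReduced hw ((conj_mem_parabolic hv).mpr ht)
  rw [h0, add_zero]

theorem eq_one_of_parity_eq_zero {v : M.Group} (hv : v ∈ parabolic M X)
    (h : ∀ t ∈ parabolic M X, parity M v t = 0) : v = 1 := by
  by_contra h1
  obtain ⟨q, hq, hne⟩ := exists_parity_simple_ne_zero hv h1
  exact hne (h _ (simple_mem_parabolic hq))

/-- An element is `(X, ∅)`-reduced exactly when it has no left inversion in `W_X`. -/
theorem isReduced_iff_parity {w : M.Group} :
    IsReduced M X ∅ w ↔ ∀ t ∈ parabolic M X, parity M w t = 0 := by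
  refine ⟨fun h t ht => parity_eq_zero_of_isReduced h ht, fun h => ?_⟩
  obtain ⟨w', v, hv, hw', rfl⟩ := exists_isDecomposition M X w
  have hv1 : v = 1 := eq_one_of_parity_eq_zero hv fun t ht => by
    rw [← parity_mul_of_isReduced hv hw' ht, h t ht]
  rwa [hv1, one_mul]

theorem isReduced_one : IsReduced M X ∅ (1 : M.Group) :=
  isReduced_iff_parity.mpr fun t _ => M.toCoxeterSystem.invParity_one t

theorem eq_one_of_isReduced_mul {v w : M.Group} (hv : v ∈ parabolic M X)
    (hw : IsReduced M X ∅ w) (hvw : IsReduced M X ∅ (v * w)) : v = 1 :=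
  eq_one_of_parity_eq_zero hv fun t ht => by
    rw [← parity_mul_of_isReduced hv hw ht, parity_eq_zero_of_isReduced hvw ht]

theorem IsDecomposition.unique {u v w v' w' : M.Group} (h : IsDecomposition M X u v w)
    (h' : IsDecomposition M X u v' w') : v = v' ∧ w = w' := by
  obtain ⟨hv, hw, rfl⟩ := h
  obtain ⟨hv', hw', he⟩ := h'
  have hw'' : w' = v'⁻¹ * v * w := by rw [mul_assoc, he, inv_mul_cancel_left]
  have h1 : v'⁻¹ * v = 1 :=
    eq_one_of_isReduced_mul (mul_mem (inv_mem hv') hv) hw (hw'' ▸ hw')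
  exact ⟨(inv_mul_eq_one.mp h1).symm, by rw [hw'', h1, one_mul]⟩

theorem existsUnique_isDecomposition (M : CoxeterMatrix I) (X : Set I) (u : M.Group) :
    ∃! p : M.Group × M.Group, IsDecomposition M X u p.1 p.2 := by
  obtain ⟨w, v, h⟩ := exists_isDecomposition M X u
  refine ⟨(v, w), h, fun p hp => ?_⟩
  obtain ⟨h1, h2⟩ := hp.unique h
  exact Prod.ext h1 h2

theorem IsDecomposition.reducedPart_eq {u v w : M.Group} (h : IsDecomposition M X u v w) :
    reducedPart M X u = w := by
  obtain ⟨v', h'⟩ := (exists_isDecomposition M X u).choose_spec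
  exact (h'.unique h).2

theorem parity_mul_simple (w t : M.Group) (i : I) [Decidable (t = w * M.simple i * w⁻¹)] :
    parity M (w * M.simple i) t =
      parity M w t + if t = w * M.simple i * w⁻¹ then 1 else 0 := by
  have h : w⁻¹ * t * w = M.simple i ↔ t = w * M.simple i * w⁻¹ := by
    rw [eq_mul_inv_iff_mul_eq, mul_assoc, inv_mul_eq_iff_eq_mul]
  classical
  rw [parity_mul, parity_simple]
  simp only [h]

/-- Multiplying by s_i on the right alters the parity at the single reflection w s_i w⁻¹. -/
theorem isReduced_mul_simple {w : M.Group} (hw : IsReduced M X ∅ w) {i : I}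
    (h : w * M.simple i * w⁻¹ ∉ parabolic M X) : IsReduced M X ∅ (w * M.simple i) := by
  classical
  refine isReduced_iff_parity.mpr fun t ht => ?_
  rw [parity_mul_simple, parity_eq_zero_of_isReduced hw ht, if_neg, add_zero]
  rintro rfl
  exact h ht

/-- If `w` is `(X, ∅)`-reduced and `w s w⁻¹` lies in `W_X` for a generator `s`, then `w s w⁻¹` is
itself a generator in `S_X`. -/
theorem exists_simple_eq_conj {w : M.Group} (hw : IsReduced M X ∅ w) {i : I}
    (h : w * M.simple i * w⁻¹ ∈ parabolic M X) :
    ∃ q : X, w * M.simple i * w⁻¹ = M.simple q := by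
  classical
  have hne : w * M.simple i * w⁻¹ ≠ 1 := by
    intro h1
    rw [mul_inv_eq_one, mul_eq_left] at h1
    have h2 := M.toCoxeterSystem.length_simple i
    change M.toCoxeterSystem.length (M.simple i) = 1 at h2
    rw [h1, CoxeterSystem.length_one] at h2
    exact zero_ne_one h2
  -- Let r = w s_i w⁻¹ and let s_q be a left descent of r. As r w = w s_i, the parity of r at s_q is
  -- that of w s_i, which is nonzero only if s_q = r.
  obtain ⟨q, hq, hqt⟩ := exists_parity_simple_ne_zero h hne
  rw [← parity_mul_of_isReduced h hw (simple_mem_parabolic hq), inv_mul_cancel_right,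
    parity_mul_simple, parity_eq_zero_of_isReduced hw (simple_mem_parabolic hq), zero_add] at hqt
  refine ⟨⟨q, hq⟩, ?_⟩
  by_contra hcon
  exact hqt (if_neg fun h' => hcon h'.symm)

end Parabolic

/-! ### The two word maps as one recursion over the letters -/

section Projection

variable (M : CoxeterMatrix I) (X : Set I)

open Classical in
/-- The word on `Σ_X ∪ Σ_X⁻¹` read off from `ω` starting at the `(X, ∅)`-reduced element `w`: a letter
`σ_i^ε` for which `w s_i w⁻¹ = s_q` with `q ∈ X` contributes `σ_q^ε`, and any other letter `σ_i^ε`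
contributes nothing and replaces `w` by `w s_i`. -/
def project : M.Group → SignedWord I → SignedWord X
  | _, [] => []
  | w, x :: ω =>
    if h : ∃ q : X, w * M.simple x.1 * w⁻¹ = M.simple q then (h.choose, x.2) :: project w ω
    else project (w * M.simple x.1) ω

open Classical in
/-- The `(X, ∅)`-reduced element reached from `w` after reading `ω`. -/
def finalState : M.Group → SignedWord I → M.Group
  | w, [] => w
  | w, x :: ω =>
    if ∃ q : X, w * M.simple x.1 * w⁻¹ = M.simple q then finalState w ω
    else finalState (w * M.simple x.1) ω

variable {M X}

theorem choose_eq_of_simple_eq {g : M.Group} {q : X} (h : ∃ q : X, g = M.simple q)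
    (hq : g = M.simple q) : h.choose = q :=
  Subtype.ext (simple_injective M (h.choose_spec.symm.trans hq))

theorem project_cons_of_eq {w : M.Group} {x : I × Bool} {q : X}
    (h : w * M.simple x.1 * w⁻¹ = M.simple q) (ω : SignedWord I) :
    project M X w (x :: ω) = (q, x.2) :: project M X w ω := by
  have hex : ∃ q : X, w * M.simple x.1 * w⁻¹ = M.simple q := ⟨q, h⟩
  rw [project, dif_pos hex, choose_eq_of_simple_eq hex h]

theorem project_cons_of_not {w : M.Group} {x : I × Bool}
    (h : ¬ ∃ q : X, w * M.simple x.1 * w⁻¹ = M.simple q) (ω : SignedWord I) :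
    project M X w (x :: ω) = project M X (w * M.simple x.1) ω := by
  rw [project, dif_neg h]

theorem conj_notMem_parabolic {w : M.Group} (hw : IsReduced M X ∅ w) {i : I}
    (h : ¬ ∃ q : X, w * M.simple i * w⁻¹ = M.simple q) :
    w * M.simple i * w⁻¹ ∉ parabolic M X :=
  fun hmem => h (exists_simple_eq_conj hw hmem)

theorem conj_simple_mem_parabolic (q : X) (g : M.Group) :
    MulAut.conj (M.simple q) g ∈ parabolic M X ↔ g ∈ parabolic M X := by
  have hq : (M.simple q)⁻¹ ∈ parabolic M X := inv_mem (simple_mem_parabolic q.2)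
  have := conj_mem_parabolic (t := g) hq
  rwa [inv_inv] at this

theorem map_conj_mul (w w' : M.Group) (l : List M.Group) :
    l.map (MulAut.conj (w * w')) = (l.map (MulAut.conj w')).map (MulAut.conj w) := by
  rw [map_mul, List.map_map]
  rfl

open Classical in
theorem filter_zip_map_conj_simple (q : X) (l : List M.Group) (l' : List Bool) :
    ((l.map (MulAut.conj (M.simple q))).zip l').filter (fun p => p.1 ∈ parabolic M X) =
      ((l.zip l').filter (fun p => p.1 ∈ parabolic M X)).map
        (Prod.map (MulAut.conj (M.simple q)) id) := by
  rw [List.zip_map_left, List.filter_map]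
  congr 1
  apply List.filter_congr
  intro p _
  simp only [Function.comp_apply, Prod.map_fst, decide_eq_decide]
  exact conj_simple_mem_parabolic q p.1

open Classical in
/-- The pairs formed by a term of `R(θ* ω)` lying in `W_X`, after conjugation by `w`, and its
exponent are those attached to the projected word. -/
theorem zip_reflSeq_project {w : M.Group} (hw : IsReduced M X ∅ w) (ω : SignedWord I) :
    (reflSeq M ((project M X w ω).map fun x => (x.1 : I))).zip ((project M X w ω).map Prod.snd) =
      (((reflSeq M (thetaStar ω)).map (MulAut.conj w)).zip (ω.map Prod.snd)).filter
        (fun p => p.1 ∈ parabolic M X) := by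
  induction ω generalizing w with
  | nil => rfl
  | cons x ω ih =>
    have hcons : reflSeq M (thetaStar (x :: ω)) = M.simple x.1 ::
        (reflSeq M (thetaStar ω)).map (MulAut.conj (M.simple x.1)) := rfl
    rw [hcons, List.map_cons, ← map_conj_mul, List.map_cons, List.zip_cons_cons,
      MulAut.conj_apply]
    by_cases h : ∃ q : X, w * M.simple x.1 * w⁻¹ = M.simple q
    · obtain ⟨q, hq⟩ := h
      -- The remaining reflections are conjugated by w s_i = s_q w. The outer conjugation by s_q
      -- preserves W_X and matches the recursion of `reflSeq` on the emitted word.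
      have hwq : w * M.simple x.1 = M.simple q * w := by rw [← hq, inv_mul_cancel_right]
      have hcons' : reflSeq M (((q, x.2) :: project M X w ω).map fun x => (x.1 : I)) =
        M.simple q :: (reflSeq M ((project M X w ω).map fun x => (x.1 : I))).map
          (MulAut.conj (M.simple q)) := rfl
      rw [List.filter_cons_of_pos (by simpa [hq] using simple_mem_parabolic q.2),
        project_cons_of_eq hq, hcons', List.map_cons, List.zip_cons_cons, hq, hwq, map_conj_mul,
        List.zip_map_left, ih hw, filter_zip_map_conj_simple]
    · rw [project_cons_of_not h, List.filter_cons_of_neg (by simpa using conj_notMem_parabolic hw h)]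
      exact ih (isReduced_mul_simple hw (conj_notMem_parabolic hw h))

theorem reflSeq_injective (M : CoxeterMatrix I) : Function.Injective (reflSeq M) := by
  intro ω ω' h
  induction ω generalizing ω' with
  | nil =>
    cases ω' with
    | nil => rfl
    | cons j ω' => exact absurd h.symm (List.cons_ne_nil _ _)
  | cons i ω ih =>
    cases ω' with
    | nil => exact absurd h (List.cons_ne_nil _ _)
    | cons j ω' =>
      obtain ⟨h1, h2⟩ := List.cons.inj h
      obtain rfl : i = j := simple_injective M h1
      rw [ih (List.map_injective_iff.mpr (MulAut.conj _).injective h2)]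

theorem length_reflSeq (ω : List I) : (reflSeq M ω).length = ω.length :=
  M.toCoxeterSystem.length_leftInvSeq ω

open Classical in
theorem reflSeq_project {w : M.Group} (hw : IsReduced M X ∅ w) (ω : SignedWord I) :
    reflSeq M ((project M X w ω).map fun x => (x.1 : I)) =
      ((reflSeq M (thetaStar ω)).map (MulAut.conj w)).filter (fun r => r ∈ parabolic M X) := by
  have h := congrArg (List.map Prod.fst) (zip_reflSeq_project hw ω)
  rw [List.map_fst_zip (by simp [length_reflSeq])] at h
  rw [h]
  conv_rhs => rw [← List.map_fst_zip (l₁ := (reflSeq M (thetaStar ω)).map (MulAut.conj w))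
    (l₂ := ω.map Prod.snd) (by simp [length_reflSeq, thetaStar]), List.filter_map]
  rfl

theorem map_conj_one (l : List M.Group) : l.map (MulAut.conj 1) = l := by
  simp

theorem isProjectedWord_project (ω : SignedWord I) :
    IsProjectedWord M X (thetaStar ω) ((project M X 1 ω).map Prod.fst) := by
  rw [IsProjectedWord, List.map_map, reflSeqIn]
  refine (reflSeq_project isReduced_one ω).trans ?_
  rw [map_conj_one]

theorem IsProjectedWord.unique {w : List I} {v v' : List X} (h : IsProjectedWord M X w v)
    (h' : IsProjectedWord M X w v') : v = v' :=
  List.map_injective_iff.mpr Subtype.val_injective (reflSeq_injective M (Eq.trans h h'.symm))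

theorem existsUnique_isProjectedWord (M : CoxeterMatrix I) (X : Set I) (w : List I) :
    ∃! v : List X, IsProjectedWord M X w v := by
  have h := isProjectedWord_project (M := M) (X := X) (w.map fun i => (i, true))
  have hw : thetaStar (w.map fun i => (i, true)) = w := by
    simp [thetaStar, Function.comp_def]
  rw [hw] at h
  exact ⟨_, h, fun v hv => hv.unique h⟩

theorem piStar_eq_project (ω : SignedWord I) : piStar M X ω = project M X 1 ω := by
  have h := isProjectedWord_project (M := M) (X := X) ω
  have hex : ∃ v, IsProjectedWord M X (thetaStar ω) v := ⟨_, h⟩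
  have hword : projectedWord M X (thetaStar ω) = (project M X 1 ω).map Prod.fst := by
    rw [projectedWord, dif_pos hex]
    exact hex.choose_spec.unique h
  have hsigns : keptSigns M X ω = (project M X 1 ω).map Prod.snd := by
    have h := congrArg (List.map Prod.snd) (zip_reflSeq_project (M := M) (X := X) isReduced_one ω)
    rw [List.map_snd_zip (by simp [length_reflSeq]), map_conj_one] at h
    exact h.symm
  rw [piStar, hword, hsigns, List.zip_map']
  simp

open Classical in
/-- The word `(q, ε)` if `t = s_q` with `q ∈ X`, and the empty word if there is no such `q`. -/
def letterOf (M : CoxeterMatrix I) (X : Set I) (t : M.Group) (ε : Bool) : SignedWord X :=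
  if h : ∃ q : X, t = M.simple q then [(h.choose, ε)] else []

/-- The contribution of the letter `x` in position `j` of a word read from the element `u`, where `θ`
is the word without exponents. -/
def hatLetterFrom (M : CoxeterMatrix I) (X : Set I) (u : M.Group) (θ : List I) (j : ℕ)
    (x : I × Bool) : SignedWord X :=
  let w := if x.2 = true then reducedPart M X (u * toCoxeter M (θ.take j))
    else reducedPart M X (u * toCoxeter M (θ.take (j + 1)))
  letterOf M X (w * M.simple x.1 * w⁻¹) x.2

theorem hatLetterFrom_cons_succ (u : M.Group) (i : I) (θ : List I) (j : ℕ) :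
    hatLetterFrom M X u (i :: θ) (j + 1) = hatLetterFrom M X (u * M.simple i) θ j := by
  have h (n : ℕ) : u * toCoxeter M ((i :: θ).take (n + 1)) =
      u * M.simple i * toCoxeter M (θ.take n) := by
    rw [List.take_succ_cons, toCoxeter, CoxeterSystem.wordProd_cons, mul_assoc]
    rfl
  ext1 x
  rw [hatLetterFrom, hatLetterFrom, h, h]

/-- The case split on ε is immaterial: the reduced parts before and after the letter differ at most
by a right factor s_i, which commutes with s_i. -/
theorem hatLetterFrom_of_conj_eq {u w : M.Group} {i : I} {ε : Bool} {θ : List I}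
    (h0 : reducedPart M X u = w)
    (h1 : reducedPart M X (u * M.simple i) = w ∨
      reducedPart M X (u * M.simple i) = w * M.simple i) :
    hatLetterFrom M X u (i :: θ) 0 (i, ε) = project M X w [(i, ε)] := by
  have e0 : u * toCoxeter M ((i :: θ).take 0) = u := by simp [toCoxeter]
  have e1 : u * toCoxeter M ((i :: θ).take (0 + 1)) = u * M.simple i := by
    simp [toCoxeter]
  have hc : ∀ w', (w' = w ∨ w' = w * M.simple i) →
      w' * M.simple i * w'⁻¹ = w * M.simple i * w⁻¹ := by
    rintro w' (rfl | rfl)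
    · rfl
    · group
  have hletter : (if ε = true then reducedPart M X u else reducedPart M X (u * M.simple i)) = w ∨
      (if ε = true then reducedPart M X u else reducedPart M X (u * M.simple i)) =
        w * M.simple i := by
    cases ε
    · exact h1
    · exact Or.inl h0
  rw [hatLetterFrom, e0, e1]
  simp only [hc _ hletter]
  rfl

/-- The state w is the reduced part of the element u read so far. Keeping an arbitrary start u lets
the induction pass to the tail of the word. -/
theorem project_eq_flatten {u w : M.Group} (hu : reducedPart M X u = w) (ω : SignedWord I) :
    project M X w ω = (ω.mapIdx (hatLetterFrom M X u (thetaStar ω))).flatten := by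
  induction ω generalizing u w with
  | nil => rfl
  | cons x ω ih =>
    obtain ⟨i, ε⟩ := x
    obtain ⟨v, hv, hw, hvw⟩ := (exists_isDecomposition M X u).choose_spec
    change IsReduced M X ∅ (reducedPart M X u) at hw
    change u = v * reducedPart M X u at hvw
    rw [hu] at hw hvw
    have hθ : thetaStar ((i, ε) :: ω) = i :: thetaStar ω := rfl
    rw [List.mapIdx_cons, List.flatten_cons, hθ]
    simp only [hatLetterFrom_cons_succ]
    by_cases h : ∃ q : X, w * M.simple i * w⁻¹ = M.simple q
    · obtain ⟨q, hq⟩ := h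
      have hnext : reducedPart M X (u * M.simple i) = w := by
        refine IsDecomposition.reducedPart_eq (v := v * M.simple q)
          ⟨mul_mem hv (simple_mem_parabolic q.2), hw, ?_⟩
        rw [← hq, hvw]
        group
      rw [hatLetterFrom_of_conj_eq hu (Or.inl hnext), ← ih hnext, project_cons_of_eq hq,
        project_cons_of_eq hq]
      rfl
    · have hnext : reducedPart M X (u * M.simple i) = w * M.simple i :=
        IsDecomposition.reducedPart_eq (v := v)
          ⟨hv, isReduced_mul_simple hw (conj_notMem_parabolic hw h), by rw [hvw, mul_assoc]⟩
      rw [hatLetterFrom_of_conj_eq hu (Or.inr hnext), ← ih hnext, project_cons_of_not h,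
        project_cons_of_not h]
      rfl

theorem piHat_eq_project (ω : SignedWord I) : piHat M X ω = project M X 1 ω := by
  have h1 : reducedPart M X (1 : M.Group) = 1 :=
    IsDecomposition.reducedPart_eq (v := 1) ⟨one_mem _, isReduced_one, (mul_one 1).symm⟩
  rw [project_eq_flatten h1, piHat, List.mapIdx_eq_ofFn]
  congr 2
  ext1 j
  simp only [hatLetterFrom, one_mul]
  rfl

end Projection

/-! ### Elements reduced on both sides -/

section BiReduced

variable {M : CoxeterMatrix I} {X Y : Set I}

/-- Take w₀ shortest in w W_Y. An inversion t ∈ W_X of w₀ not present in w must be cancelled by d,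
so w₀⁻¹ t w₀ ∈ W_Y; this would be an inversion of w₀⁻¹, which is (Y, ∅)-reduced. -/
theorem exists_biReduced (w : M.Group) (hw : IsReduced M X ∅ w) (Y : Set I) :
    ∃ w₀ d : M.Group, w = w₀ * d ∧ d ∈ parabolic M Y ∧ IsReduced M X ∅ w₀ ∧
      IsReduced M Y ∅ w₀⁻¹ := by
  obtain ⟨u, v, hv, hu, hvu⟩ := exists_isDecomposition M Y w⁻¹
  have hwd : w = u⁻¹ * v⁻¹ := by rw [← mul_inv_rev, ← hvu, inv_inv]
  refine ⟨u⁻¹, v⁻¹, hwd, inv_mem hv, isReduced_iff_parity.mpr fun t ht => ?_, by rwa [inv_inv]⟩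
  by_contra h
  have h1 : parity M v⁻¹ (u * t * u⁻¹) ≠ 0 := by
    intro h0
    have := parity_eq_zero_of_isReduced hw ht
    rw [hwd, parity_mul, inv_inv, h0, add_zero] at this
    exact h this
  have h2 := parity_eq_zero_of_isReduced hu (mem_parabolic_of_parity_ne_zero (inv_mem hv) h1)
  have h3 := parity_mul u⁻¹ u t
  rw [inv_mul_cancel, inv_inv, h2, add_zero] at h3
  exact h (h3.symm.trans (M.toCoxeterSystem.invParity_one t))

/-- Pull back a left descent s_q of w r w⁻¹: since (w r w⁻¹) w = w r, the reflection w⁻¹ s_q w has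
odd parity in r. It therefore lies in W_Y and, w⁻¹ being reduced, is a generator. -/
theorem exists_descent_of_conj_mem {w r : M.Group} (hX : IsReduced M X ∅ w)
    (hY : IsReduced M Y ∅ w⁻¹) (hr : r ∈ parabolic M Y) (hr1 : r ≠ 1)
    (h : w * r * w⁻¹ ∈ parabolic M X) :
    ∃ y ∈ Y, parity M r (M.simple y) ≠ 0 ∧ w * M.simple y * w⁻¹ ∈ parabolic M X := by
  have hne : w * r * w⁻¹ ≠ 1 := by
    intro h1
    rw [mul_inv_eq_one, mul_eq_left] at h1
    exact hr1 h1
  obtain ⟨q, hq, hqr⟩ := exists_parity_simple_ne_zero h hne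
  rw [← parity_mul_of_isReduced h hX (simple_mem_parabolic hq), inv_mul_cancel_right, parity_mul,
    parity_eq_zero_of_isReduced hX (simple_mem_parabolic hq), zero_add] at hqr
  have hmem := mem_parabolic_of_parity_ne_zero hr hqr
  obtain ⟨y, hy⟩ := exists_simple_eq_conj hY (i := q) (by rwa [inv_inv])
  rw [inv_inv] at hy
  rw [hy] at hqr
  refine ⟨y, y.2, hqr, ?_⟩
  rw [← hy]
  have : w * (w⁻¹ * M.simple q * w) * w⁻¹ = M.simple q := by group
  rw [this]
  exact simple_mem_parabolic hq

/-- If `w` is `(X, ∅)`-reduced and `w` does not conjugate both of `s_i`, `s_j` into `W_X`, then it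
conjugates at most one nontrivial element of `⟨s_i, s_j⟩` into `W_X`. -/
theorem eq_of_conj_mem_parabolic {w : M.Group} (hw : IsReduced M X ∅ w) {i j : I}
    (hij : ¬ (w * M.simple i * w⁻¹ ∈ parabolic M X ∧ w * M.simple j * w⁻¹ ∈ parabolic M X))
    {r r' : M.Group} (hr : r ∈ parabolic M {i, j}) (hr' : r' ∈ parabolic M {i, j})
    (hr1 : r ≠ 1) (hr1' : r' ≠ 1) (h : w * r * w⁻¹ ∈ parabolic M X)
    (h' : w * r' * w⁻¹ ∈ parabolic M X) : r = r' := by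
  obtain ⟨w₀, d, rfl, hd, hX, hY⟩ := exists_biReduced w hw {i, j}
  -- Otherwise w₀ d w₀⁻¹ ∈ W_X, and w₀ and w = (w₀ d w₀⁻¹) w₀ are reduced in the same coset; so w =
  -- w₀, against `hij`.
  have hij₀ : ¬ (w₀ * M.simple i * w₀⁻¹ ∈ parabolic M X ∧
      w₀ * M.simple j * w₀⁻¹ ∈ parabolic M X) := by
    rintro ⟨hi, hj⟩
    have hle : parabolic M {i, j} ≤ (parabolic M X).comap (MulAut.conj w₀).toMonoidHom := by
      rw [parabolic, Subgroup.closure_le]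
      rintro _ ⟨k, rfl | rfl, rfl⟩
      exacts [hi, hj]
    have hd' : w₀ * d * w₀⁻¹ ∈ parabolic M X := hle hd
    have h1 := eq_one_of_isReduced_mul hd' hX (by rwa [inv_mul_cancel_right])
    rw [mul_inv_eq_one] at h1
    rw [h1] at hij
    exact hij ⟨hi, hj⟩
  have hunique : ∀ y ∈ ({i, j} : Set I), ∀ y' ∈ ({i, j} : Set I),
      w₀ * M.simple y * w₀⁻¹ ∈ parabolic M X → w₀ * M.simple y' * w₀⁻¹ ∈ parabolic M X →
      y = y' := by
    rintro y (rfl | rfl) y' (rfl | rfl) h1 h2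
    exacts [rfl, absurd ⟨h1, h2⟩ hij₀, absurd ⟨h2, h1⟩ hij₀, rfl]
  -- If r ≠ s_y for a descent y of r, then s_y r has a descent too, which by `hunique` is again y;
  -- but r and s_y r have opposite parities at s_y.
  have hsimple : ∀ r ∈ parabolic M {i, j}, r ≠ 1 → w₀ * r * w₀⁻¹ ∈ parabolic M X →
      ∃ y ∈ ({i, j} : Set I), w₀ * M.simple y * w₀⁻¹ ∈ parabolic M X ∧ r = M.simple y := by
    intro r hr hr1 h
    obtain ⟨y, hy, hyr, hyX⟩ := exists_descent_of_conj_mem hX hY hr hr1 h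
    refine ⟨y, hy, hyX, ?_⟩
    have hinv : (M.simple y)⁻¹ = M.simple y := M.toCoxeterSystem.inv_simple y
    by_contra hne
    have h1 : M.simple y * r ≠ 1 := by
      intro h1
      rw [mul_eq_one_iff_inv_eq, hinv] at h1
      exact hne h1.symm
    have hconj : w₀ * (M.simple y * r) * w₀⁻¹ ∈ parabolic M X := by
      have := mul_mem hyX h
      have e : w₀ * M.simple y * w₀⁻¹ * (w₀ * r * w₀⁻¹) = w₀ * (M.simple y * r) * w₀⁻¹ := by group
      rwa [e] at this
    obtain ⟨y', hy', hyr', hyX'⟩ :=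
      exists_descent_of_conj_mem hX hY (mul_mem (simple_mem_parabolic hy) hr) h1 hconj
    obtain rfl := hunique y hy y' hy' hyX hyX'
    classical
    rw [parity_mul, parity_simple, if_pos rfl, inv_mul_cancel, one_mul,
      Fin.eq_one_of_ne_zero (parity M r (M.simple y)) hyr] at hyr'
    exact hyr' rfl
  have hconj : ∀ r ∈ parabolic M {i, j}, r ≠ 1 → w₀ * d * r * (w₀ * d)⁻¹ ∈ parabolic M X →
      ∃ y ∈ ({i, j} : Set I), w₀ * M.simple y * w₀⁻¹ ∈ parabolic M X ∧
        d * r * d⁻¹ = M.simple y := by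
    intro r hr hr1 h
    refine hsimple _ (mul_mem (mul_mem hd hr) (inv_mem hd)) ?_ ?_
    · intro h1
      rw [mul_inv_eq_one, mul_eq_left] at h1
      exact hr1 h1
    · have e : w₀ * (d * r * d⁻¹) * w₀⁻¹ = w₀ * d * r * (w₀ * d)⁻¹ := by group
      rwa [e]
  obtain ⟨y, hy, hyX, hyr⟩ := hconj r hr hr1 h
  obtain ⟨y', hy', hyX', hyr'⟩ := hconj r' hr' hr1' h'
  obtain rfl := hunique y hy y' hy' hyX hyX'
  exact mul_left_cancel (mul_right_cancel (hyr.trans hyr'.symm))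

end BiReduced

/-! ### Braid relations -/

section Braid

open CoxeterSystem (altWord)

variable {M : CoxeterMatrix I} {X : Set I}

/-- A word on `Σ_I` seen as a word on `Σ_I ∪ Σ_I⁻¹`. -/
def positiveWord (w : List I) : SignedWord I := w.map fun i => (i, true)

theorem thetaStar_positiveWord (w : List I) : thetaStar (positiveWord w) = w := by
  simp [thetaStar, positiveWord, Function.comp_def]

theorem toArtin_positiveWord (M : CoxeterMatrix I) (w : List I) :
    toArtin M (positiveWord w) = PresentedGroup.mk (relators M) ((w.map FreeGroup.of).prod) := by
  rw [toArtin]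
  congr 1
  induction w with
  | nil => rfl
  | cons i w ih =>
    rw [List.map_cons, List.prod_cons, ← ih]
    rfl

theorem toArtin_braidWord (M : CoxeterMatrix I) {i j : I} (hij : i ≠ j) (h : M i j ≠ 0) :
    toArtin M (positiveWord (CoxeterSystem.braidWord M i j)) =
      toArtin M (positiveWord (CoxeterSystem.braidWord M j i)) := by
  rw [toArtin_positiveWord, toArtin_positiveWord, ← mul_inv_eq_one, ← map_inv, ← map_mul]
  exact PresentedGroup.one_of_mem ⟨i, j, hij, h, rfl⟩

theorem toArtin_altWord (M : CoxeterMatrix I) {i j : I} (hij : i ≠ j) (h : M i j ≠ 0) :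
    toArtin M (positiveWord (altWord i j (M i j))) =
      toArtin M (positiveWord (altWord j i (M i j))) := by
  have hb := toArtin_braidWord M hij h
  rw [CoxeterSystem.braidWord, CoxeterSystem.braidWord, M.symmetric j i,
    CoxeterSystem.alternatingWord_eq_altWord, CoxeterSystem.alternatingWord_eq_altWord] at hb
  split_ifs at hb
  exacts [hb, hb.symm]

/-- All exponents stay positive, so for positive words it suffices to compare the underlying
letters, hence the reflections. -/
theorem project_positiveWord (w : M.Group) (v : List I) :
    project M X w (positiveWord v) =
      positiveWord ((project M X w (positiveWord v)).map Prod.fst) := by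
  induction v generalizing w with
  | nil => rfl
  | cons i v ih =>
    change project M X w ((i, true) :: positiveWord v) =
      positiveWord ((project M X w ((i, true) :: positiveWord v)).map Prod.fst)
    by_cases h : ∃ q : X, w * M.simple i * w⁻¹ = M.simple q
    · obtain ⟨q, hq⟩ := h
      rw [project_cons_of_eq hq, List.map_cons]
      exact congrArg _ (ih w)
    · rw [project_cons_of_not h]
      exact ih _

theorem project_altWord {w : M.Group} {i j : I} {p q : X}
    (hp : w * M.simple i * w⁻¹ = M.simple p) (hq : w * M.simple j * w⁻¹ = M.simple q) (n : ℕ) :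
    project M X w (positiveWord (altWord i j n)) = positiveWord (altWord p q n) := by
  induction n generalizing i j p q with
  | zero => rfl
  | succ n ih =>
    change project M X w ((i, true) :: positiveWord (altWord j i n)) = _
    rw [project_cons_of_eq hp, ih hq hp]
    rfl

/-- The two sides of a braid relation list the same reflections in opposite orders. -/
theorem reflSeq_altWord_reverse (M : CoxeterMatrix I) (i j : I) :
    (reflSeq M (altWord j i (M i j))).reverse = reflSeq M (altWord i j (M i j)) := by
  rw [reflSeq, reflSeq, CoxeterSystem.leftInvSeq_altWord, CoxeterSystem.leftInvSeq_altWord]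
  apply List.ext_getElem (by simp)
  intro k hk hk'
  rw [List.length_map, List.length_range] at hk'
  simp only [List.getElem_reverse, List.getElem_map, List.getElem_range, List.length_map,
    List.length_range]
  set a := M.toCoxeterSystem.simple i
  set b := M.toCoxeterSystem.simple j
  have ha : a * a = 1 := M.toCoxeterSystem.simple_mul_simple_self i
  have hb : b * b = 1 := M.toCoxeterSystem.simple_mul_simple_self j
  have hinv : b * a = (a * b)⁻¹ := by
    rw [mul_inv_rev, inv_eq_of_mul_eq_one_right ha, inv_eq_of_mul_eq_one_right hb]
  have hpow : (a * b) ^ (M i j - 1 - k) * (a * b) ^ (k + 1) = 1 := by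
    rw [← pow_add, show M i j - 1 - k + (k + 1) = M i j by omega]
    exact M.toCoxeterSystem.simple_mul_simple_pow i j
  rw [hinv, inv_pow, inv_eq_of_mul_eq_one_right hpow, pow_succ]
  simp only [mul_assoc, hb, mul_one]

theorem nodup_reflSeq_altWord (M : CoxeterMatrix I) (i j : I) :
    (reflSeq M (altWord i j (M i j))).Nodup := by
  rw [reflSeq, CoxeterSystem.leftInvSeq_altWord]
  refine List.Nodup.map_on ?_ List.nodup_range
  intro k hk l hl h
  rw [List.mem_range] at hk hl
  refine pow_injOn_Iio_orderOf (x := M.simple i * M.simple j) ?_ ?_ (mul_right_cancel h)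
  · rw [orderOf_simple_mul_simple]; exact hk
  · rw [orderOf_simple_mul_simple]; exact hl

open Classical in
/-- The projections of the two sides of a braid relation represent the same element of `A_X`. -/
theorem toArtin_project_altWord {w : M.Group} (hw : IsReduced M X ∅ w) {i j : I} (hij : i ≠ j)
    (h0 : M i j ≠ 0) :
    toArtin (restrict M X) (project M X w (positiveWord (altWord i j (M i j)))) =
      toArtin (restrict M X) (project M X w (positiveWord (altWord j i (M i j)))) := by
  by_cases hE : w * M.simple i * w⁻¹ ∈ parabolic M X ∧ w * M.simple j * w⁻¹ ∈ parabolic M X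
  · obtain ⟨p, hp⟩ := exists_simple_eq_conj hw hE.1
    obtain ⟨q, hq⟩ := exists_simple_eq_conj hw hE.2
    -- Labels are orders of products of generators, and conjugation by w preserves orders.
    have hpq : restrict M X p q = M i j := by
      change M p q = M i j
      rw [← orderOf_simple_mul_simple, ← orderOf_simple_mul_simple, ← hp, ← hq,
        ← MulEquiv.orderOf_eq (MulAut.conj w) (M.simple i * M.simple j), map_mul]
      rfl
    have hne : p ≠ q := by
      rintro rfl
      exact hij (simple_injective M (mul_left_cancel (mul_right_cancel (hp.trans hq.symm))))
    rw [project_altWord hp hq, project_altWord hq hp, ← hpq]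
    exact toArtin_altWord (restrict M X) hne (hpq ▸ h0)
  -- The two lists are reverses of each other; having at most one term, they agree. Distinctness of
  -- the reflections excludes two equal surviving terms.
  · have key : ((reflSeq M (altWord i j (M i j))).map (MulAut.conj w)).filter
          (fun r => r ∈ parabolic M X) =
        ((reflSeq M (altWord j i (M i j))).map (MulAut.conj w)).filter
          (fun r => r ∈ parabolic M X) := by
      set L := ((reflSeq M (altWord j i (M i j))).map (MulAut.conj w)).filter
        (fun r => r ∈ parabolic M X) with hL
      have hrev : ((reflSeq M (altWord i j (M i j))).map (MulAut.conj w)).filter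
          (fun r => r ∈ parabolic M X) = L.reverse := by
        rw [← reflSeq_altWord_reverse, List.map_reverse, List.filter_reverse]
      have hmem : ∀ t ∈ L, ∃ r ∈ parabolic M {i, j}, r ≠ 1 ∧ w * r * w⁻¹ ∈ parabolic M X ∧
          t = w * r * w⁻¹ := by
        intro t ht
        rw [hL, List.mem_filter, List.mem_map] at ht
        obtain ⟨⟨r, hr, rfl⟩, hrX⟩ := ht
        have halt : ∀ (n : ℕ) (a b : I), ∀ k ∈ altWord a b n, k ∈ ({a, b} : Set I) := by
          intro n
          induction n with
          | zero => simp [altWord]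
          | succ n ih =>
            intro a b k hk
            rcases List.mem_cons.mp hk with rfl | hk
            · simp
            · exact Set.pair_comm b a ▸ ih b a k hk
        refine ⟨r, Set.pair_comm j i ▸ mem_parabolic_of_mem_leftInvSeq (halt _ _ _) hr, ?_,
          of_decide_eq_true hrX, rfl⟩
        rintro rfl
        have := (M.toCoxeterSystem.isReflection_of_mem_leftInvSeq _ hr).odd_length
        rw [CoxeterSystem.length_one] at this
        exact absurd this (by decide)
      have hnodup : L.Nodup := by
        have h := nodup_reflSeq_altWord M i j
        rw [← reflSeq_altWord_reverse, List.nodup_reverse] at h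
        exact (h.map (MulAut.conj w).injective).filter _
      have hlen : L.length ≤ 1 := by
        rcases hcase : L with _ | ⟨t, _ | ⟨t', l⟩⟩
        · simp
        · simp
        · exfalso
          rw [hcase] at hnodup hmem
          obtain ⟨r, hr, hr1, hrX, rfl⟩ := hmem t (by simp)
          obtain ⟨r', hr', hr1', hrX', rfl⟩ := hmem t' (by simp)
          have := eq_of_conj_mem_parabolic hw hE hr hr' hr1 hr1' hrX hrX'
          simp [this] at hnodup
      rw [hrev]
      rcases hcase : L with _ | ⟨t, _ | ⟨t', l⟩⟩
      · rfl
      · rfl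
      · rw [hcase] at hlen
        simp at hlen
    have hword : (project M X w (positiveWord (altWord i j (M i j)))).map (fun x => (x.1 : I)) =
        (project M X w (positiveWord (altWord j i (M i j)))).map (fun x => (x.1 : I)) := by
      apply reflSeq_injective M
      rw [reflSeq_project hw, reflSeq_project hw, thetaStar_positiveWord, thetaStar_positiveWord,
        key]
    have hfst : (project M X w (positiveWord (altWord i j (M i j)))).map Prod.fst =
        (project M X w (positiveWord (altWord j i (M i j)))).map Prod.fst := by
      apply List.map_injective_iff.mpr Subtype.val_injective
      rw [List.map_map, List.map_map]
      exact hword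
    rw [project_positiveWord, hfst, ← project_positiveWord]

end Braid

/-! ### The induced action of the Artin-Tits group -/

section Action

variable {M : CoxeterMatrix I} {X : Set I}

theorem finalState_cons_of_eq {w : M.Group} {x : I × Bool} {q : X}
    (h : w * M.simple x.1 * w⁻¹ = M.simple q) (ω : SignedWord I) :
    finalState M X w (x :: ω) = finalState M X w ω := by
  rw [finalState, if_pos ⟨q, h⟩]

theorem finalState_cons_of_not {w : M.Group} {x : I × Bool}
    (h : ¬ ∃ q : X, w * M.simple x.1 * w⁻¹ = M.simple q) (ω : SignedWord I) :
    finalState M X w (x :: ω) = finalState M X (w * M.simple x.1) ω := by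
  rw [finalState, if_neg h]

/-- By uniqueness of decompositions, the final state depends only on the starting state and the
image of the word in W_I, hence is the same for both sides of a braid relation. -/
theorem exists_isDecomposition_finalState {w : M.Group} (hw : IsReduced M X ∅ w) (ω : SignedWord I) :
    ∃ v, IsDecomposition M X (w * toCoxeter M (thetaStar ω)) v (finalState M X w ω) := by
  induction ω generalizing w with
  | nil => exact ⟨1, one_mem _, hw, by simp [thetaStar, toCoxeter, finalState]⟩
  | cons x ω ih =>
    have hθ : toCoxeter M (thetaStar (x :: ω)) =
        M.simple x.1 * toCoxeter M (thetaStar ω) := M.toCoxeterSystem.wordProd_cons _ _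
    by_cases h : ∃ q : X, w * M.simple x.1 * w⁻¹ = M.simple q
    · obtain ⟨q, hq⟩ := h
      obtain ⟨v, hv, hf, he⟩ := ih hw
      rw [finalState_cons_of_eq hq, hθ]
      refine ⟨M.simple q * v, mul_mem (simple_mem_parabolic q.2) hv, hf, ?_⟩
      rw [mul_assoc, ← he, ← hq]
      group
    · rw [finalState_cons_of_not h, hθ, ← mul_assoc]
      exact ih (isReduced_mul_simple hw (conj_notMem_parabolic hw h))

theorem not_exists_conj_mul_simple {w : M.Group} {i : I}
    (h : ¬ ∃ q : X, w * M.simple i * w⁻¹ = M.simple q) :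
    ¬ ∃ q : X, w * M.simple i * M.simple i * (w * M.simple i)⁻¹ = M.simple q := by
  have e : w * M.simple i * M.simple i * (w * M.simple i)⁻¹ = w * M.simple i * w⁻¹ := by group
  rwa [e]

variable (M X) in
/-- The set on which the Artin-Tits group acts: an `(X, ∅)`-reduced element together with an element
of `A_X`. -/
abbrev ActionSpace : Type u := {w : M.Group // IsReduced M X ∅ w} × ArtinGroup (restrict M X)

variable (M X) in
/-- Reading a signed word from a point of the action space. -/
def readWord (ω : SignedWord I) (p : ActionSpace M X) : ActionSpace M X :=
  (⟨finalState M X p.1 ω, (exists_isDecomposition_finalState p.1.2 ω).choose_spec.2.1⟩,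
    p.2 * toArtin (restrict M X) (project M X p.1 ω))

theorem toArtin_append (M : CoxeterMatrix I) (ω ω' : SignedWord I) :
    toArtin M (ω ++ ω') = toArtin M ω * toArtin M ω' := rfl

theorem finalState_append (w : M.Group) (ω ω' : SignedWord I) :
    finalState M X w (ω ++ ω') = finalState M X (finalState M X w ω) ω' := by
  induction ω generalizing w with
  | nil => rfl
  | cons x ω ih =>
    rw [List.cons_append, finalState, finalState]
    split_ifs
    exacts [ih _, ih _]

theorem project_append (w : M.Group) (ω ω' : SignedWord I) :
    project M X w (ω ++ ω') = project M X w ω ++ project M X (finalState M X w ω) ω' := by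
  induction ω generalizing w with
  | nil => rfl
  | cons x ω ih =>
    rw [List.cons_append, project, project, finalState]
    split_ifs
    · rw [ih, List.cons_append]
    · exact ih _

theorem readWord_append (ω ω' : SignedWord I) (p : ActionSpace M X) :
    readWord M X (ω ++ ω') p = readWord M X ω' (readWord M X ω p) := by
  apply Prod.ext
  · exact Subtype.ext (finalState_append _ _ _)
  · change p.2 * toArtin _ (project M X p.1 (ω ++ ω')) =
      p.2 * toArtin _ (project M X p.1 ω) * toArtin _ (project M X (finalState M X p.1 ω) ω')
    rw [project_append, toArtin_append, mul_assoc]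

theorem toArtin_cancel (M : CoxeterMatrix I) (i : I) (ε : Bool) :
    toArtin M [(i, ε), (i, !ε)] = 1 := by
  have : FreeGroup.mk [(i, ε), (i, !ε)] = 1 :=
    Quot.sound (FreeGroup.Red.Step.not (L₁ := []) (L₂ := []))
  rw [toArtin, this, map_one]

theorem readWord_cancel (i : I) (ε : Bool) (p : ActionSpace M X) :
    readWord M X [(i, ε), (i, !ε)] p = p := by
  by_cases h : ∃ q : X, p.1 * M.simple i * (p.1 : M.Group)⁻¹ = M.simple q
  · obtain ⟨q, hq⟩ := h
    apply Prod.ext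
    · apply Subtype.ext
      change finalState M X p.1 _ = p.1
      rw [finalState_cons_of_eq hq, finalState_cons_of_eq hq]
      rfl
    · change p.2 * toArtin _ (project M X p.1 _) = p.2
      rw [project_cons_of_eq hq, project_cons_of_eq hq]
      change p.2 * toArtin (restrict M X) [(q, ε), (q, !ε)] = p.2
      rw [toArtin_cancel, mul_one]
  · have h' := not_exists_conj_mul_simple h
    apply Prod.ext
    · apply Subtype.ext
      change finalState M X p.1 _ = p.1
      rw [finalState_cons_of_not h, finalState_cons_of_not h']
      exact M.toCoxeterSystem.simple_mul_simple_cancel_right i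
    · change p.2 * toArtin _ (project M X p.1 _) = p.2
      rw [project_cons_of_not h, project_cons_of_not h']
      exact mul_one _

variable (M X) in
/-- The permutation of the action space attached to a generator. -/
def genPerm (i : I) : (Equiv.Perm (ActionSpace M X))ᵐᵒᵖ :=
  -- Words are read from left to right, so reading is a right action.
  MulOpposite.op
    { toFun := readWord M X [(i, true)]
      invFun := readWord M X [(i, false)]
      left_inv := fun p => by rw [← readWord_append]; exact readWord_cancel i true p
      right_inv := fun p => by rw [← readWord_append]; exact readWord_cancel i false p }

theorem lift_genPerm_mk (ω : SignedWord I) (p : ActionSpace M X) :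
    (FreeGroup.lift (genPerm M X) (FreeGroup.mk ω)).unop p = readWord M X ω p := by
  induction ω generalizing p with
  | nil =>
    refine Prod.ext rfl ?_
    exact (mul_one p.2).symm
  | cons x ω ih =>
    have h : FreeGroup.mk (x :: ω) = FreeGroup.mk [x] * FreeGroup.mk ω := rfl
    have hx : (FreeGroup.lift (genPerm M X) (FreeGroup.mk [x])).unop p = readWord M X [x] p := by
      obtain ⟨i, _ | _⟩ := x
      · simp only [FreeGroup.lift_mk, List.map_cons, List.map_nil, List.prod_singleton]
        rfl
      · simp only [FreeGroup.lift_mk, List.map_cons, List.map_nil, List.prod_singleton]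
        rfl
    rw [h, map_mul, MulOpposite.unop_mul, Equiv.Perm.mul_apply, hx, ih, ← readWord_append]
    rfl

theorem lift_genPerm_relator {r : FreeGroup I} (hr : r ∈ relators M) :
    FreeGroup.lift (genPerm M X) r = 1 := by
  obtain ⟨i, j, hij, h0, rfl⟩ := hr
  rw [map_mul, map_inv, mul_inv_eq_one]
  have hbraid : ∀ a b : I, braidElement M a b =
      FreeGroup.mk (positiveWord (CoxeterSystem.braidWord M a b)) := by
    intro a b
    rw [braidElement]
    generalize CoxeterSystem.braidWord M a b = v
    induction v with
    | nil => rfl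
    | cons i v ih =>
      rw [List.map_cons, List.prod_cons, ih]
      rfl
  rw [hbraid, hbraid]
  apply MulOpposite.unop_injective
  ext1 p
  rw [lift_genPerm_mk, lift_genPerm_mk]
  apply Prod.ext
  · apply Subtype.ext
    obtain ⟨v, hv⟩ := exists_isDecomposition_finalState p.1.2 (positiveWord (CoxeterSystem.braidWord M i j))
    obtain ⟨v', hv'⟩ := exists_isDecomposition_finalState p.1.2 (positiveWord (CoxeterSystem.braidWord M j i))
    rw [thetaStar_positiveWord] at hv hv'
    have : toCoxeter M (CoxeterSystem.braidWord M i j) =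
      toCoxeter M (CoxeterSystem.braidWord M j i) := M.toCoxeterSystem.wordProd_braidWord_eq i j
    rw [this] at hv
    exact (hv.unique hv').2
  · have h := toArtin_project_altWord p.1.2 hij h0
    change p.2 * toArtin _ (project M X p.1 _) = p.2 * toArtin _ (project M X p.1 _)
    rw [CoxeterSystem.braidWord, CoxeterSystem.braidWord, M.symmetric j i,
      CoxeterSystem.alternatingWord_eq_altWord, CoxeterSystem.alternatingWord_eq_altWord]
    split_ifs
    · rw [h]
    · rw [h]

theorem toArtin_project_congr {ω ω' : SignedWord I} (h : toArtin M ω = toArtin M ω') :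
    toArtin (restrict M X) (project M X 1 ω) = toArtin (restrict M X) (project M X 1 ω') := by
  have hlift : ∀ ω : SignedWord I,
      PresentedGroup.toGroup (f := genPerm M X) (fun r hr => lift_genPerm_relator hr)
        (toArtin M ω) = FreeGroup.lift (genPerm M X) (FreeGroup.mk ω) := fun _ => rfl
  have h1 : FreeGroup.lift (genPerm M X) (FreeGroup.mk ω) =
      FreeGroup.lift (genPerm M X) (FreeGroup.mk ω') := by rw [← hlift, ← hlift, h]
  -- At the base point (1, 1) the second coordinate is the class of the projected word.
  have h2 := congrArg (fun g => (g.unop (⟨1, isReduced_one⟩, 1)).2) h1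
  simp only [lift_genPerm_mk] at h2
  change 1 * toArtin (restrict M X) (project M X 1 ω) =
    1 * toArtin (restrict M X) (project M X 1 ω') at h2
  rwa [one_mul, one_mul] at h2

end Action

theorem induces_inducedMap {M : CoxeterMatrix I} {X : Set I} {φ : SignedWord I → SignedWord X}
    (h : ∀ ω ω', toArtin M ω = toArtin M ω' →
      toArtin (restrict M X) (φ ω) = toArtin (restrict M X) (φ ω')) :
    Induces M X φ (inducedMap M X φ) :=
  fun ω => h _ _ (toArtin_surjective M (toArtin M ω)).choose_spec

end

end ArtinTits

theorem mainTheorem6 {I : Type*} [Finite I] (M : CoxeterMatrix I) (X : Set I) :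
    -- the ingredients of both word maps are well defined
    (∀ w : List I, ∃! v : List X, ArtinTits.IsProjectedWord M X w v) ∧
    (∀ u : M.Group, ∃! p : M.Group × M.Group, ArtinTits.IsDecomposition M X u p.1 p.2) ∧
    -- the two word maps coincide
    ArtinTits.piStar M X = ArtinTits.piHat M X ∧
    -- both induce maps on the Artin-Tits groups, and these maps coincide
    ArtinTits.Induces M X (ArtinTits.piStar M X) (ArtinTits.piMap M X) ∧
    ArtinTits.Induces M X (ArtinTits.piHat M X) (ArtinTits.piBP M X) ∧
    ArtinTits.piMap M X = ArtinTits.piBP M X := by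
  have heq : ArtinTits.piStar M X = ArtinTits.piHat M X := by
    ext1 ω
    rw [ArtinTits.piStar_eq_project, ArtinTits.piHat_eq_project]
  have hind : ArtinTits.Induces M X (ArtinTits.piStar M X) (ArtinTits.piMap M X) := by
    refine ArtinTits.induces_inducedMap fun ω ω' h => ?_
    rw [ArtinTits.piStar_eq_project, ArtinTits.piStar_eq_project]
    exact ArtinTits.toArtin_project_congr h
  have hmap : ArtinTits.piMap M X = ArtinTits.piBP M X := by
    rw [ArtinTits.piMap, ArtinTits.piBP, heq]
  exact ⟨ArtinTits.existsUnique_isProjectedWord M X, ArtinTits.existsUnique_isDecomposition M X,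
    heq, hind, heq ▸ hmap ▸ hind, hmap⟩
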